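/- Let $\mathbb X$ be a separable metric space with metric $\|x-x'\|$ (for instance a Borel subset of a Euclidean space) that is standard Borel, $\mathbb U$ a finite nonempty action set, $\mathcal T(\cdot|x,u)$ a stochastic kernel from $\mathbb X\times\mathbb U$ to $\mathbb X$, $c:\mathbb X\times\mathbb U\to\mathbb R$ a bounded stage-wise cost and $0<\beta<1$. Let $\Gamma$ be the set of admissible policies $\gamma=(\gamma_t)_{t\ge 0}$, where $U_t=\gamma_t(X_0,\dots,X_t,U_0,\dots,U_{t-1})$ with $\gamma_t$ measurable. Put $J_\beta(x_0,\gamma)=E^{\mathcal T,\gamma}_{x_0}\big[\sum_{t\ge0}\beta^t c(X_t,U_t)\big]$ and $J^*_\beta(x_0)=\inf_{\gamma\in\Gamma}J_\beta(x_0,\gamma)$. Assume that there are constants $\alpha_c,\alpha_T>0$ such that for all $x,x'\in\mathbb X$ and $u\in\mathbb U$ $$|c(x,u)-c(x',u)|\le\alpha_c\|x-x'\|,\qquad \|\mathcal T(\cdot|x,u)-\mathcal T(\cdot|x',u)\|_{TV}\le\alpha_T\|x-x'\|,$$ where $\|\mu-\nu\|_{TV}=2\sup_{B}|\mu(B)-\nu(B)|$,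 the supremum being over Borel sets $B$. Let $B_1,\dots,B_M$ be a partition of $\mathbb X$ into Borel sets, with representatives $y_i\in B_i$, $\mathbb Y=\{y_1,\dots,y_M\}$, and $q(x)=y_i$ for $x\in B_i$. Let $\pi^*$ be a probability measure on $\mathbb X$ with $\pi^*(B_i)>0$ for all $i$, and let $\hat\pi^*_{y_i}(A)=\pi^*(A)/\pi^*(B_i)$ for measurable $A\subset B_i$. The finite model has state space $\mathbb Y$, action set $\mathbb U$, discount factor $\beta$, and cost and transition probabilities $$C^*(y_i,u)=\int_{B_i}c(x,u)\,\hat\pi^*_{y_i}(dx),\qquad P^*(y_j|y_i,u)=\int_{B_i}\mathcal T(B_j|x,u)\,\hat\pi^*_{y_i}(dx).$$ Let $L(x)=\int_{B_i}\|x-x'\|\,\hat\pi^*_{y_i}(dx')\in[0,\infty]$ for $x\in B_i$. Then the finite model has a stationary deterministic policy $f:\mathbb Y\to\mathbb U$ that is optimal, that is, one that attains the optimal discounted cost of the finite model from every initial state in $\mathbb Y$. Moreover, for every such $f$, the stationary policy $\hat\gamma(x)=f(q(x))$ on $\mathbb X$ satisfies, for every initial state $x_0\in\mathbb X$, $$\left|J_\beta(x_0,\hat\gamma)-J^*_\beta(x_0)\right|\le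 2\left(\alpha_c+\frac{\beta\alpha_T\|c\|_\infty}{1-\beta}\right)\sum_{t=0}^\infty\beta^t\sup_{\gamma\in\Gamma}E^{\mathcal T,\gamma}_{x_0}\left[L(X_t)\right],$$ where $\|c\|_\infty=\sup_{x,u}|c(x,u)|$ and the right-hand side is a value in $[0,\infty]$. -/

import Mathlib

open MeasureTheory ProbabilityTheory
open scoped ENNReal

noncomputable section

namespace QuantizedMDP

/-- The total variation metric `2 * sup_B |μ(B) - ν(B)|`, the supremum being over measurable
sets. -/
def tvDist {X : Type*} [MeasurableSpace X] (μ ν : Measure X) : ℝ :=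
  2 * ⨆ B : {B : Set X // MeasurableSet B}, |μ.real B.1 - ν.real B.1|

/-- An admissible policy: at time `t` the action is a measurable function of
`I_t = (X_0, ..., X_t, U_0, ..., U_{t-1})`, arranged here as the past pairs
`((X_0, U_0), ..., (X_{t-1}, U_{t-1}))` and the current state `X_t`. -/
structure Policy (X U : Type*) [MeasurableSpace X] [MeasurableSpace U] where
  act : (t : ℕ) → (Fin t → X × U) × X → U
  measurable_act : ∀ t, Measurable (act t)

/-- The policy that uses the same function `f` of the current state at all times. -/
def Policy.stationary {X U : Type*} [MeasurableSpace X] [MeasurableSpace U]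
    (f : X → U) (hf : Measurable f) : Policy X U where
  act _ I := f I.2
  measurable_act _ := hf.comp measurable_snd

section Control

variable {X U : Type*} [MeasurableSpace X] [MeasurableSpace U]

/-- A history up to time `n`, re-indexed by `Fin (n + 1)`. -/
def past (n : ℕ) (h : (Finset.Iic n) → X × U) : Fin (n + 1) → X × U :=
  fun i => h ⟨i, Finset.mem_Iic.2 (Nat.lt_succ_iff.1 i.2)⟩

theorem measurable_past (n : ℕ) : Measurable (past (X := X) (U := U) n) :=
  measurable_pi_lambda _ fun _ => measurable_pi_apply _

/-- The last state-action pair of a history up to time `n`. -/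
def last (n : ℕ) (h : (Finset.Iic n) → X × U) : X × U := h ⟨n, Finset.mem_Iic.2 le_rfl⟩

theorem measurable_last (n : ℕ) : Measurable (last (X := X) (U := U) n) :=
  measurable_pi_apply _

/-- The next state-action pair, from the history up to time `n` and the next state `x`. -/
def nextPair (γ : Policy X U) (n : ℕ) (p : ((Finset.Iic n) → X × U) × X) : X × U :=
  (p.2, γ.act (n + 1) (past n p.1, p.2))

theorem measurable_nextPair (γ : Policy X U) (n : ℕ) : Measurable (nextPair γ n) :=
  measurable_snd.prodMk ((γ.measurable_act (n + 1)).comp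
    (((measurable_past n).comp measurable_fst).prodMk measurable_snd))

/-- Conditional law of `(X_{n+1}, U_{n+1})` given the history up to time `n`:
`X_{n+1}` has law `T(. | X_n, U_n)` and `U_{n+1} = γ_{n+1}(I_{n+1})`. -/
def stepKernel (T : Kernel (X × U) X) (γ : Policy X U) (n : ℕ) :
    Kernel ((Finset.Iic n) → X × U) (X × U) :=
  (Kernel.id ×ₖ T.comap (last n) (measurable_last n)).map (nextPair γ n)

instance (T : Kernel (X × U) X) [IsMarkovKernel T] (γ : Policy X U) (n : ℕ) :
    IsMarkovKernel (stepKernel T γ n) :=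
  Kernel.IsMarkovKernel.map _ (measurable_nextPair γ n)

/-- The law of `((X_t, U_t))_t` started at `X_0 = x₀` under the policy `γ`. -/
def pathLaw (T : Kernel (X × U) X) [IsMarkovKernel T] (γ : Policy X U) (x₀ : X) :
    Measure (ℕ → X × U) :=
  Kernel.trajMeasure (X := fun _ => X × U)
    (Measure.dirac (x₀, γ.act 0 (Fin.elim0, x₀))) (stepKernel T γ)

/-- The discounted expected cost `J_β(x₀, γ)`. -/
def discountedCost (T : Kernel (X × U) X) [IsMarkovKernel T] (c : X → U → ℝ) (β : ℝ)
    (x₀ : X) (γ : Policy X U) : ℝ :=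
  ∫ ω, ∑' t : ℕ, β ^ t * c (ω t).1 (ω t).2 ∂(pathLaw T γ x₀)

/-- The optimal value `J*_β(x₀)`, the infimum over all admissible policies. -/
def optimalCost (T : Kernel (X × U) X) [IsMarkovKernel T] (c : X → U → ℝ) (β : ℝ)
    (x₀ : X) : ℝ :=
  ⨅ γ : Policy X U, discountedCost T c β x₀ γ

/-- A stationary policy `f` is optimal if it attains the optimal value from every initial
state. -/
def IsOptimalStationary (T : Kernel (X × U) X) [IsMarkovKernel T] (c : X → U → ℝ) (β : ℝ)
    (f : X → U) (hf : Measurable f) : Prop :=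
  ∀ x, discountedCost T c β x (Policy.stationary f hf) = optimalCost T c β x

end Control

/-- A finite quantization of `X` with a weighting probability measure. The bins are the fibres
`q ⁻¹' {y}`: measurable, disjoint, covering `X`, indexed by their representatives `y ∈ Y`,
each of which lies in its own bin. Each bin has positive weight. -/
structure Quantization (X : Type*) [MeasurableSpace X] where
  Y : Finset X
  q : X → Y
  measurable_q : Measurable q
  q_rep : ∀ y : Y, q y = y
  weight : Measure X
  isProb : IsProbabilityMeasure weight
  weight_pos : ∀ y : Y, 0 < weight (q ⁻¹' {y})

namespace Quantization

variable {X U : Type*} [MeasurableSpace X] [MeasurableSpace U]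

/-- The quantization bin with representative `y`. -/
def bin (Q : Quantization X) (y : Q.Y) : Set X := Q.q ⁻¹' {y}

/-- The normalized weight measure on the bin of `y`: `A ↦ π(A ∩ B_y) / π(B_y)`. -/
def binMeasure (Q : Quantization X) (y : Q.Y) : Measure X :=
  ProbabilityTheory.cond Q.weight (Q.bin y)

variable [MeasurableSingletonClass X]

theorem measurableSet_bin (Q : Quantization X) (y : Q.Y) : MeasurableSet (Q.bin y) :=
  Q.measurable_q (measurableSet_singleton y)

/-- The stage-wise cost `C*(y, u)` of the finite model. -/
def finCost (Q : Quantization X) (c : X → U → ℝ) (y : Q.Y) (u : U) : ℝ :=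
  ∫ x in Q.bin y, c x u ∂(Q.binMeasure y)

/-- The transition probability `P*(z | y, u)` of the finite model. -/
def finProb (Q : Quantization X) (T : Kernel (X × U) X) (y : Q.Y) (u : U) (z : Q.Y) : ℝ≥0∞ :=
  ∫⁻ x in Q.bin y, T (x, u) (Q.bin z) ∂(Q.binMeasure y)

/-- The transition kernel of the finite model: `z` has probability `P*(z | y, u)`. -/
def finKernel [Countable U] [MeasurableSingletonClass U] (Q : Quantization X)
    (T : Kernel (X × U) X) : Kernel (Q.Y × U) Q.Y :=
  Kernel.ofFunOfCountable fun p => ∑ z : Q.Y, Q.finProb T p.1 p.2 z • Measure.dirac z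

theorem binMeasure_bin (Q : Quantization X) (y : Q.Y) : Q.binMeasure y (Q.bin y) = 1 := by
  have := Q.isProb
  unfold binMeasure
  rw [cond_apply (Q.measurableSet_bin y), Set.inter_self]
  exact ENNReal.inv_mul_cancel (Q.weight_pos y).ne' (measure_ne_top _ _)

theorem sum_finProb (Q : Quantization X) (T : Kernel (X × U) X) [IsMarkovKernel T]
    (y : Q.Y) (u : U) : ∑ z : Q.Y, Q.finProb T y u z = 1 := by
  unfold finProb
  rw [← lintegral_finsetSum]
  · have h : ∀ x, ∑ z : Q.Y, T (x, u) (Q.bin z) = 1 := by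
      intro x
      have h1 := sum_measure_preimage_singleton (μ := T (x, u)) (f := Q.q) Finset.univ
        fun y _ => Q.measurableSet_bin y
      simpa [bin] using h1
    simp only [h, lintegral_const, one_mul, Measure.restrict_apply_univ, Q.binMeasure_bin y]
  · intro z _
    exact (Kernel.measurable_coe T (Q.measurableSet_bin z)).comp measurable_prodMk_right

instance [Countable U] [MeasurableSingletonClass U] (Q : Quantization X)
    (T : Kernel (X × U) X) [IsMarkovKernel T] : IsMarkovKernel (Q.finKernel T) := by
  refine ⟨fun p => ⟨?_⟩⟩
  have h := Q.sum_finProb T p.1 p.2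
  simpa [finKernel, Kernel.ofFunOfCountable] using h

end Quantization

/-- The average loss `L(x) = ∫_{B} d(x, x') π̂(dx')`, where `B` is the bin of `x` and `π̂` its
normalized weight measure, as an extended nonnegative number. -/
def Quantization.loss {X : Type*} [MetricSpace X] [MeasurableSpace X] (Q : Quantization X)
    (x : X) : ℝ≥0∞ :=
  ∫⁻ x' in Q.bin (Q.q x), edist x x' ∂(Q.binMeasure (Q.q x))

end QuantizedMDP

end

/-!
The proof compares both costs with one function on `X`, namely `v = V ∘ q`, where `V` is the optimal
value of the finite model, obtained as the fixed point of its Bellman operator.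

For a bounded measurable `v`, write `(B v)(x, u) = c(x, u) + β ∫ v dT(. | x, u)` (`actionValue`).
Telescoping gives, for every admissible policy `γ`,
`J(x₀, γ) - v(x₀) = ∑ β ^ t E[(B v)(X_t, U_t) - v(X_t)]` (`hasSum_discountedCost_sub`), an identity
that involves the policy only through the laws of the pairs `(X_t, U_t)`. Hence no measurable
selection and no Bellman equation on `X` are needed: pointwise bounds on the residual `B v - v`
suffice.

For `v = V ∘ q` these bounds come from the finite model. Its backup of `V` at `(q(x), u)` is the
average of `(B v)(x', u)` over `x'` in the bin of `x` (`Quantization.actionValue_finKernel`). Since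
`c(., u)` and `T(. | ., u)` are Lipschitz and `|V| ≤ ‖c‖ / (1 - β)`, it differs from `(B v)(x, u)`
by at most `C L(x)` with `C = αc + β αT ‖c‖ / (1 - β)`
(`Quantization.ofReal_abs_actionValue_sub_le`). By the Bellman equation the finite backup is at
least `V(q(x)) = v(x)`, with equality at `u = f(q(x))` when `f` is optimal
(`IsOptimalStationary.greedy`). So `B v - v ≥ -C L` for all actions and `B v - v ≤ C L` along the
quantized policy `γ̂`. With `S = ∑ β ^ t sup_γ E[L(X_t)]`, assumed finite as there is nothing to prove
otherwise, this gives `v(x₀) - C S ≤ J*(x₀) ≤ J(x₀, γ̂) ≤ v(x₀) + C S`.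
-/

namespace QuantizedMDP

/-! ### Laws of the controlled process -/

section Control

variable {X U : Type*} [MeasurableSpace X] [MeasurableSpace U]

instance (T : Kernel (X × U) X) [IsMarkovKernel T] (γ : Policy X U) (x₀ : X) :
    IsProbabilityMeasure (pathLaw T γ x₀) := by
  unfold pathLaw; infer_instance

theorem map_zero_pathLaw (T : Kernel (X × U) X) [IsMarkovKernel T] (γ : Policy X U) (x₀ : X) :
    (pathLaw T γ x₀).map (fun ω => ω 0) = Measure.dirac (x₀, γ.act 0 (Fin.elim0, x₀)) := by
  have h0 : (fun ω : ℕ → X × U => ω 0) =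
      (fun h : Finset.Iic 0 → X × U => h ⟨0, Finset.mem_Iic.2 le_rfl⟩) ∘
        Preorder.frestrictLe (π := fun _ => X × U) 0 := rfl
  rw [h0, ← Measure.map_map (by fun_prop) (by fun_prop), pathLaw, Kernel.trajMeasure,
    Measure.map_comp _ _ (by fun_prop), Kernel.traj_map_frestrictLe, Kernel.partialTraj_self,
    Measure.id_comp, Measure.map_map (by fun_prop) (by fun_prop)]
  exact Measure.map_id

theorem map_history_pathLaw (T : Kernel (X × U) X) [IsMarkovKernel T] (γ : Policy X U) (x₀ : X)
    (n : ℕ) :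
    (pathLaw T γ x₀).map
        (fun ω => (Preorder.frestrictLe (π := fun _ => X × U) n ω, ω (n + 1))) =
      (pathLaw T γ x₀).map (Preorder.frestrictLe n) ⊗ₘ stepKernel T γ n :=
  Kernel.map_frestrictLe_trajMeasure_compProd_eq_map_trajMeasure.symm

/-- Whatever the policy, `X_{n+1}` is drawn from `T(. | X_n, U_n)`: the law of `X_{n+1}` is the law
of `(X_n, U_n)` composed with `T`. For a general policy, the argument uses nothing else
about the dynamics after time `0`. -/
theorem map_state_succ_pathLaw (T : Kernel (X × U) X) [IsMarkovKernel T] (γ : Policy X U)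
    (x₀ : X) (n : ℕ) :
    (pathLaw T γ x₀).map (fun ω => (ω (n + 1)).1) =
      T ∘ₘ (pathLaw T γ x₀).map (fun ω => ω n) := by
  have h : (fun ω : ℕ → X × U => (ω (n + 1)).1) = (fun p => p.2.1) ∘
      (fun ω => (Preorder.frestrictLe (π := fun _ => X × U) n ω, ω (n + 1))) := rfl
  have hn : (fun ω : ℕ → X × U => ω n) =
      last n ∘ Preorder.frestrictLe (π := fun _ => X × U) n := rfl
  rw [h, hn, ← Measure.map_map (by fun_prop) (by fun_prop), map_history_pathLaw,
    ← Measure.map_map (measurable_last n) (by fun_prop)]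
  ext s hs
  rw [Measure.map_apply (by fun_prop) hs, Measure.compProd_apply (by measurability),
    Measure.bind_apply hs (Kernel.aemeasurable _),
    lintegral_map (T.measurable_coe hs) (measurable_last n)]
  refine lintegral_congr fun h => ?_
  have hs' : MeasurableSet
      (Prod.mk h ⁻¹' ((fun p : (Finset.Iic n → X × U) × (X × U) => p.2.1) ⁻¹' s)) := by
    measurability
  rw [stepKernel, Kernel.map_apply' _ (measurable_nextPair γ n) _ hs',
    Kernel.prod_apply, Kernel.id_apply, Kernel.comap_apply]
  have : nextPair γ n ⁻¹'
      (Prod.mk h ⁻¹' ((fun p : (Finset.Iic n → X × U) × (X × U) => p.2.1) ⁻¹' s)) =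
      Set.univ ×ˢ s := by
    ext p; simp [nextPair]
  rw [this, Measure.prod_prod]; simp

theorem ae_action_stationary [Countable U] [MeasurableSingletonClass U] (T : Kernel (X × U) X)
    [IsMarkovKernel T] (f : X → U) (hf : Measurable f) (x₀ : X) (n : ℕ) :
    ∀ᵐ ω ∂(pathLaw T (Policy.stationary f hf) x₀), (ω n).2 = f (ω n).1 := by
  have hm : MeasurableSet {p : X × U | p.2 = f p.1} :=
    measurableSet_eq_fun measurable_snd (hf.comp measurable_fst)
  cases n with
  | zero =>
    have h : ∀ᵐ p ∂((pathLaw T (Policy.stationary f hf) x₀).map (fun ω => ω 0)),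
        p.2 = f p.1 := by
      rw [map_zero_pathLaw, ae_dirac_iff hm]
      rfl
    exact ae_of_ae_map (measurable_pi_apply 0).aemeasurable h
  | succ n =>
    have h : ∀ᵐ p ∂((pathLaw T (Policy.stationary f hf) x₀).map
        (fun ω => (Preorder.frestrictLe (π := fun _ => X × U) n ω, ω (n + 1)))),
        p.2.2 = f p.2.1 := by
      rw [map_history_pathLaw, Measure.ae_compProd_iff
        (p := fun p : (Finset.Iic n → X × U) × (X × U) => p.2.2 = f p.2.1) (measurable_snd hm)]
      refine Filter.Eventually.of_forall fun h => ?_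
      rw [stepKernel, Kernel.map_apply _ (measurable_nextPair _ n),
        ae_map_iff (measurable_nextPair _ n).aemeasurable hm]
      exact Filter.Eventually.of_forall fun p => rfl
    exact ae_of_ae_map (by fun_prop) h

end Control

/-! ### Bounds on integrals and series -/

theorem integrable_comp_of_bounded {Ω Z : Type*} [MeasurableSpace Ω] [MeasurableSpace Z]
    (μ : Measure Ω) [IsFiniteMeasure μ] {g : Ω → Z} (hg : Measurable g) {φ : Z → ℝ}
    (hφ : Measurable φ) {K : ℝ} (hK : ∀ z, |φ z| ≤ K) : Integrable (fun ω => φ (g ω)) μ :=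
  .of_bound (hφ.comp hg).aestronglyMeasurable K (Filter.Eventually.of_forall fun _ => hK _)

theorem abs_integral_le_of_bounded {Ω : Type*} [MeasurableSpace Ω] (μ : Measure Ω)
    [IsProbabilityMeasure μ] {φ : Ω → ℝ} {K : ℝ} (hK : ∀ ω, |φ ω| ≤ K) : |∫ ω, φ ω ∂μ| ≤ K := by
  simpa using norm_integral_le_of_norm_le_const (μ := μ)
    (Filter.Eventually.of_forall fun ω => (Real.norm_eq_abs _).trans_le (hK ω))

theorem ofReal_integral_le_lintegral_ofReal {α : Type*} [MeasurableSpace α] (μ : Measure α)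
    (f : α → ℝ) : ENNReal.ofReal (∫ a, f a ∂μ) ≤ ∫⁻ a, ENNReal.ofReal (f a) ∂μ := by
  by_cases hf : Integrable f μ
  · rw [integral_eq_lintegral_pos_part_sub_lintegral_neg_part hf]
    exact (ENNReal.ofReal_le_ofReal (sub_le_self _ ENNReal.toReal_nonneg)).trans
      ENNReal.ofReal_toReal_le
  · simp [integral_undef hf]

theorem ofReal_le_tsum_of_hasSum {a : ℕ → ℝ} {D : ℝ} (h : HasSum a D) :
    ENNReal.ofReal D ≤ ∑' t, ENNReal.ofReal (a t) := by
  refine le_of_tendsto ((ENNReal.continuous_ofReal.tendsto D).comp h)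
    (Filter.Eventually.of_forall fun s => ?_)
  refine le_trans ?_ (ENNReal.sum_le_tsum s)
  exact Finset.le_sum_of_subadditive _ ENNReal.ofReal_zero.le
    (fun _ _ => ENNReal.ofReal_add_le) _ _

/-- The bound is stated in `ℝ≥0∞`, so that the errors `e t` need be neither measurable nor
integrable. -/
theorem ofReal_le_tsum_lintegral {α : Type*} [MeasurableSpace α] (μ : Measure α) {β D : ℝ}
    (hβ : 0 ≤ β) {h : ℕ → α → ℝ} {e : ℕ → α → ℝ≥0∞}
    (hD : HasSum (fun t => β ^ t * ∫ a, h t a ∂μ) D)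
    (he : ∀ t, ∀ᵐ a ∂μ, ENNReal.ofReal (h t a) ≤ e t a) :
    ENNReal.ofReal D ≤ ∑' t, ENNReal.ofReal (β ^ t) * ∫⁻ a, e t a ∂μ := by
  refine (ofReal_le_tsum_of_hasSum hD).trans (ENNReal.tsum_le_tsum fun t => ?_)
  rw [ENNReal.ofReal_mul (pow_nonneg hβ t)]
  gcongr
  exact (ofReal_integral_le_lintegral_ofReal μ _).trans (lintegral_mono_ae (he t))

/-! ### The discounted Bellman residual identity -/

section Bellman

variable {X U : Type*} [MeasurableSpace X] [MeasurableSpace U]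

/-- The one-step Bellman backup `c(x, u) + β ∫ v dT(. | x, u)`: the cost of playing `u` at `x` and
receiving the terminal cost `v` at the next state. -/
noncomputable def actionValue (T : Kernel (X × U) X) (c : X → U → ℝ) (β : ℝ) (v : X → ℝ)
    (x : X) (u : U) : ℝ :=
  c x u + β * ∫ x', v x' ∂(T (x, u))

theorem measurable_actionValue (T : Kernel (X × U) X) {c : X → U → ℝ}
    (hc : Measurable (Function.uncurry c)) (β : ℝ) {v : X → ℝ} (hv : Measurable v) (u : U) :
    Measurable fun x => actionValue T c β v x u :=
  (hc.comp measurable_prodMk_right).add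
    ((hv.stronglyMeasurable.integral_kernel.measurable.comp measurable_prodMk_right).const_mul β)

theorem abs_actionValue_le (T : Kernel (X × U) X) [IsMarkovKernel T] {c : X → U → ℝ} {K : ℝ}
    (hK : ∀ x u, |c x u| ≤ K) {β : ℝ} (hβ0 : 0 ≤ β) {v : X → ℝ} {K' : ℝ} (hK' : ∀ x, |v x| ≤ K')
    (x : X) (u : U) : |actionValue T c β v x u| ≤ K + β * K' := by
  refine (abs_add_le _ _).trans (add_le_add (hK x u) ?_)
  rw [abs_mul, abs_of_nonneg hβ0]
  exact mul_le_mul_of_nonneg_left (abs_integral_le_of_bounded _ hK') hβ0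

theorem hasSum_discountedCost (T : Kernel (X × U) X) [IsMarkovKernel T] {c : X → U → ℝ}
    (hc : Measurable (Function.uncurry c)) {K : ℝ} (hK : ∀ x u, |c x u| ≤ K) {β : ℝ} (hβ0 : 0 ≤ β)
    (hβ1 : β < 1) (γ : Policy X U) (x₀ : X) :
    HasSum (fun t => β ^ t * ∫ ω, c (ω t).1 (ω t).2 ∂(pathLaw T γ x₀))
      (discountedCost T c β x₀ γ) := by
  have hint : ∀ t, Integrable (fun ω : ℕ → X × U => c (ω t).1 (ω t).2) (pathLaw T γ x₀) :=
    fun t => integrable_comp_of_bounded (pathLaw T γ x₀) (g := fun ω => ω t)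
      (measurable_pi_apply t) hc fun p : X × U => hK p.1 p.2
  have := hasSum_integral_of_summable_integral_norm (μ := pathLaw T γ x₀)
    (F := fun t ω => β ^ t * c (ω t).1 (ω t).2) (fun t => (hint t).const_mul _) ?_
  · simp only [integral_const_mul] at this
    exact this
  · refine .of_nonneg_of_le (fun t => integral_nonneg fun _ => norm_nonneg _) (fun t => ?_)
      ((summable_geometric_of_lt_one hβ0 hβ1).mul_right K)
    refine (le_abs_self _).trans (abs_integral_le_of_bounded _ fun ω => ?_)
    rw [Real.norm_eq_abs, abs_abs, abs_mul, abs_of_nonneg (pow_nonneg hβ0 t)]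
    exact mul_le_mul_of_nonneg_left (hK _ _) (pow_nonneg hβ0 t)

theorem abs_discountedCost_le (T : Kernel (X × U) X) [IsMarkovKernel T] {c : X → U → ℝ}
    (hc : Measurable (Function.uncurry c)) {K : ℝ} (hK : ∀ x u, |c x u| ≤ K) {β : ℝ} (hβ0 : 0 ≤ β)
    (hβ1 : β < 1) (γ : Policy X U) (x₀ : X) : |discountedCost T c β x₀ γ| ≤ K / (1 - β) := by
  have h := (hasSum_geometric_of_lt_one hβ0 hβ1).mul_right K
  rw [inv_mul_eq_div] at h
  refine (hasSum_discountedCost T hc hK hβ0 hβ1 γ x₀).norm_le_of_bounded h fun t => ?_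
  rw [Real.norm_eq_abs, abs_mul, abs_of_nonneg (pow_nonneg hβ0 t)]
  exact mul_le_mul_of_nonneg_left (abs_integral_le_of_bounded _ fun ω => hK _ _)
    (pow_nonneg hβ0 t)

theorem integral_state_succ (T : Kernel (X × U) X) [IsMarkovKernel T] (γ : Policy X U) (x₀ : X)
    {v : X → ℝ} (hv : Measurable v) {K : ℝ} (hK : ∀ x, |v x| ≤ K) (n : ℕ) :
    ∫ ω, v (ω (n + 1)).1 ∂(pathLaw T γ x₀) =
      ∫ ω, ∫ x', v x' ∂(T (ω n)) ∂(pathLaw T γ x₀) := by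
  have h1 := integral_map (μ := pathLaw T γ x₀) (φ := fun ω => (ω (n + 1)).1)
    (measurable_pi_apply (n + 1)).fst.aemeasurable hv.aestronglyMeasurable
  rw [← h1, map_state_succ_pathLaw, Measure.comp_eq_comp_const_apply,
    ProbabilityTheory.Kernel.integral_comp
    (.of_bound hv.aestronglyMeasurable K (Filter.Eventually.of_forall hK)),
    Kernel.const_apply,
    integral_map (measurable_pi_apply n).aemeasurable
      hv.stronglyMeasurable.integral_kernel.aestronglyMeasurable]

/-- The cost of any policy, relative to any bounded function `v`, is the expected discounted sum of
the Bellman residuals of `v` along the path: the terms `β ^ (t + 1) * E[v(X_{t+1})]` and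
`β ^ t * E[v(X_t)]` telescope. -/
theorem hasSum_discountedCost_sub (T : Kernel (X × U) X) [IsMarkovKernel T] {c : X → U → ℝ}
    (hc : Measurable (Function.uncurry c)) {K : ℝ} (hK : ∀ x u, |c x u| ≤ K) {β : ℝ} (hβ0 : 0 ≤ β)
    (hβ1 : β < 1) {v : X → ℝ} (hv : Measurable v) {K' : ℝ} (hK' : ∀ x, |v x| ≤ K')
    (γ : Policy X U) (x₀ : X) :
    HasSum (fun t => β ^ t *
        ∫ ω, (actionValue T c β v (ω t).1 (ω t).2 - v (ω t).1) ∂(pathLaw T γ x₀))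
      (discountedCost T c β x₀ γ - v x₀) := by
  set a : ℕ → ℝ := fun t => ∫ ω, v (ω t).1 ∂(pathLaw T γ x₀) with ha
  have ha0 : a 0 = v x₀ := by
    have h1 := integral_map (μ := pathLaw T γ x₀) (φ := fun ω => ω 0) (f := fun p => v p.1)
      (measurable_pi_apply 0).aemeasurable (hv.comp measurable_fst).aestronglyMeasurable
    rw [map_zero_pathLaw, integral_dirac' (fun p : X × U => v p.1) _
      (hv.comp measurable_fst).stronglyMeasurable] at h1
    exact h1.symm
  have hsum : Summable fun t => β ^ t * a t := by
    refine .of_norm_bounded ((summable_geometric_of_lt_one hβ0 hβ1).mul_right K') fun t => ?_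
    rw [Real.norm_eq_abs, abs_mul, abs_of_nonneg (pow_nonneg hβ0 t)]
    exact mul_le_mul_of_nonneg_left (abs_integral_le_of_bounded _ fun ω => hK' _)
      (pow_nonneg hβ0 t)
  have hshift : HasSum (fun t => β ^ (t + 1) * a (t + 1)) ((∑' t, β ^ t * a t) - v x₀) := by
    have := (hasSum_nat_add_iff' 1).2 hsum.hasSum
    simpa [ha0] using this
  have h := ((hasSum_discountedCost T hc hK hβ0 hβ1 γ x₀).add hshift).sub hsum.hasSum
  convert! h using 1
  · funext t
    have i1 : Integrable (fun ω : ℕ → X × U => c (ω t).1 (ω t).2) (pathLaw T γ x₀) :=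
      integrable_comp_of_bounded (pathLaw T γ x₀) (g := fun ω => ω t)
      (measurable_pi_apply t) hc fun p : X × U => hK p.1 p.2
    have i2 : Integrable (fun ω : ℕ → X × U => ∫ x', v x' ∂(T (ω t))) (pathLaw T γ x₀) :=
      integrable_comp_of_bounded (pathLaw T γ x₀) (g := fun ω => ω t) (measurable_pi_apply t)
        hv.stronglyMeasurable.integral_kernel.measurable fun p => abs_integral_le_of_bounded _ hK'
    have i3 : Integrable (fun ω : ℕ → X × U => v (ω t).1) (pathLaw T γ x₀) :=
      integrable_comp_of_bounded _ (measurable_pi_apply t).fst hv hK'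
    have i12 : Integrable (fun ω : ℕ → X × U =>
        c (ω t).1 (ω t).2 + β * ∫ x', v x' ∂(T (ω t))) (pathLaw T γ x₀) :=
      i1.add (i2.const_mul β)
    simp only [actionValue, Prod.mk.eta]
    rw [integral_sub i12 i3, integral_add i1 (i2.const_mul β),
      integral_const_mul, ← integral_state_succ T γ x₀ hv hK' t]
    simp only [ha]
    ring
  · ring

/-- If `v` exceeds every backup of `v` by at most the error `e`, then `v x₀` exceeds the cost of
every policy by at most the expected discounted error along the path. -/
theorem ofReal_value_sub_discountedCost_le (T : Kernel (X × U) X) [IsMarkovKernel T]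
    {c : X → U → ℝ} (hc : Measurable (Function.uncurry c)) {K : ℝ} (hK : ∀ x u, |c x u| ≤ K)
    {β : ℝ} (hβ0 : 0 ≤ β) (hβ1 : β < 1) {v : X → ℝ} (hv : Measurable v) {K' : ℝ}
    (hK' : ∀ x, |v x| ≤ K') {e : X → ℝ≥0∞}
    (he : ∀ x u, ENNReal.ofReal (v x - actionValue T c β v x u) ≤ e x)
    (γ : Policy X U) (x₀ : X) :
    ENNReal.ofReal (v x₀ - discountedCost T c β x₀ γ) ≤
      ∑' t : ℕ, ENNReal.ofReal (β ^ t) * ∫⁻ ω, e (ω t).1 ∂(pathLaw T γ x₀) := by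
  have h := (hasSum_discountedCost_sub T hc hK hβ0 hβ1 hv hK' γ x₀).neg
  simp only [neg_sub, ← mul_neg, ← integral_neg] at h
  exact ofReal_le_tsum_lintegral _ hβ0 h fun t => Filter.Eventually.of_forall fun ω => he _ _

/-- If the backup of `v` under `f` exceeds `v` by at most the error `e`, then the cost of the
stationary policy `f` exceeds `v x₀` by at most the expected discounted error along the path. -/
theorem ofReal_discountedCost_stationary_sub_le [Countable U] [MeasurableSingletonClass U]
    (T : Kernel (X × U) X) [IsMarkovKernel T]
    {c : X → U → ℝ} (hc : Measurable (Function.uncurry c)) {K : ℝ} (hK : ∀ x u, |c x u| ≤ K)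
    {β : ℝ} (hβ0 : 0 ≤ β) (hβ1 : β < 1) {v : X → ℝ} (hv : Measurable v) {K' : ℝ}
    (hK' : ∀ x, |v x| ≤ K') {e : X → ℝ≥0∞} (f : X → U) (hf : Measurable f)
    (he : ∀ x, ENNReal.ofReal (actionValue T c β v x (f x) - v x) ≤ e x) (x₀ : X) :
    ENNReal.ofReal (discountedCost T c β x₀ (Policy.stationary f hf) - v x₀) ≤
      ∑' t : ℕ, ENNReal.ofReal (β ^ t) *
        ∫⁻ ω, e (ω t).1 ∂(pathLaw T (Policy.stationary f hf) x₀) := by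
  refine ofReal_le_tsum_lintegral _ hβ0
    (hasSum_discountedCost_sub T hc hK hβ0 hβ1 hv hK' _ x₀) fun t => ?_
  filter_upwards [ae_action_stationary T f hf x₀ t] with ω hω
  rw [hω]
  exact he _

end Bellman

/-! ### Optimality in finite models -/

theorem abs_ciInf_sub_ciInf_le {ι : Type*} [Finite ι] [Nonempty ι] {g h : ι → ℝ} {r : ℝ}
    (hr : ∀ i, |g i - h i| ≤ r) : |(⨅ i, g i) - ⨅ i, h i| ≤ r := by
  obtain ⟨i, hi⟩ := exists_eq_ciInf_of_finite (f := g)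
  obtain ⟨j, hj⟩ := exists_eq_ciInf_of_finite (f := h)
  have h1 := ciInf_le (Set.finite_range g).bddBelow j
  have h2 := ciInf_le (Set.finite_range h).bddBelow i
  have h3 := abs_le.1 (hr i)
  have h4 := abs_le.1 (hr j)
  rw [abs_le]
  constructor <;> linarith

theorem exists_greedy {S U : Type*} [MeasurableSpace S] [MeasurableSpace U] [Finite U] [Nonempty U]
    (P : Kernel (S × U) S) (c : S → U → ℝ) {β : ℝ} {V : S → ℝ}
    (hV : ∀ s, V s = ⨅ u, actionValue P c β V s u) :
    ∃ f : S → U, ∀ s, actionValue P c β V s (f s) = V s := by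
  choose f hf using fun s => exists_eq_ciInf_of_finite (f := actionValue P c β V s)
  exact ⟨f, fun s => (hf s).trans (hV s).symm⟩

section Finite

variable {S U : Type*} [Finite S] [MeasurableSpace S] [MeasurableSingletonClass S]
  [Finite U] [MeasurableSpace U]

/-- The Bellman operator of a finite model is a `β`-contraction in the supremum norm. -/
theorem exists_bellman_fixed_point [Nonempty U] (P : Kernel (S × U) S) [IsMarkovKernel P]
    (c : S → U → ℝ) {β : ℝ} (hβ0 : 0 ≤ β) (hβ1 : β < 1) :
    ∃ V : S → ℝ, ∀ s, V s = ⨅ u, actionValue P c β V s u := by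
  have := Fintype.ofFinite S
  let Φ : (S → ℝ) → S → ℝ := fun V s => ⨅ u, actionValue P c β V s u
  have hΦ : ContractingWith ⟨β, hβ0⟩ Φ := by
    refine ⟨by exact_mod_cast hβ1, LipschitzWith.of_dist_le_mul fun V W => ?_⟩
    refine (dist_pi_le_iff (by positivity)).2 fun s => abs_ciInf_sub_ciInf_le fun u => ?_
    have h : |∫ s', (V s' - W s') ∂(P (s, u))| ≤ dist V W :=
      abs_integral_le_of_bounded _ fun s' => dist_le_pi_dist V W s'
    rw [integral_sub .of_finite .of_finite] at h
    rw [actionValue, actionValue, add_sub_add_left_eq_sub, ← mul_sub, abs_mul, abs_of_nonneg hβ0]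
    exact mul_le_mul_of_nonneg_left h hβ0
  exact ⟨hΦ.fixedPoint, fun s => (congrFun hΦ.fixedPoint_isFixedPt s).symm⟩

variable [MeasurableSingletonClass U]

theorem bellman_le_discountedCost (P : Kernel (S × U) S) [IsMarkovKernel P] (c : S → U → ℝ)
    {β : ℝ} (hβ0 : 0 ≤ β) (hβ1 : β < 1) {V : S → ℝ}
    (hV : ∀ s, V s = ⨅ u, actionValue P c β V s u) (γ : Policy S U) (s : S) :
    V s ≤ discountedCost P c β s γ := by
  obtain ⟨K, hK⟩ := (Set.finite_range fun p : S × U => |c p.1 p.2|).bddAbove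
  obtain ⟨K', hK'⟩ := (Set.finite_range fun s => |V s|).bddAbove
  have h := ofReal_value_sub_discountedCost_le P (measurable_of_finite (Function.uncurry c))
    (fun x u => hK ⟨(x, u), rfl⟩) hβ0 hβ1 (measurable_of_finite V) (fun x => hK' ⟨x, rfl⟩)
    (e := 0) (fun x u => ?_) γ s
  · simpa using h
  · have h2 := ciInf_le (Set.finite_range (actionValue P c β V x)).bddBelow u
    rw [← hV x] at h2
    simpa using h2

theorem discountedCost_greedy (P : Kernel (S × U) S) [IsMarkovKernel P] (c : S → U → ℝ)
    {β : ℝ} (hβ0 : 0 ≤ β) (hβ1 : β < 1) {V : S → ℝ}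
    (hV : ∀ s, V s = ⨅ u, actionValue P c β V s u) {f : S → U}
    (hf : ∀ s, actionValue P c β V s (f s) = V s) (s : S) :
    discountedCost P c β s (Policy.stationary f (measurable_of_finite f)) = V s := by
  obtain ⟨K, hK⟩ := (Set.finite_range fun p : S × U => |c p.1 p.2|).bddAbove
  obtain ⟨K', hK'⟩ := (Set.finite_range fun s => |V s|).bddAbove
  have h := ofReal_discountedCost_stationary_sub_le P (measurable_of_finite (Function.uncurry c))
    (fun x u => hK ⟨(x, u), rfl⟩) hβ0 hβ1 (measurable_of_finite V) (fun x => hK' ⟨x, rfl⟩)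
    (e := 0) f (measurable_of_finite f) (fun x => by simp [hf x]) s
  exact le_antisymm (by simpa using h) (bellman_le_discountedCost P c hβ0 hβ1 hV _ s)

theorem optimalCost_eq_of_bellman [Nonempty U] (P : Kernel (S × U) S) [IsMarkovKernel P]
    (c : S → U → ℝ) {β : ℝ} (hβ0 : 0 ≤ β) (hβ1 : β < 1) {V : S → ℝ}
    (hV : ∀ s, V s = ⨅ u, actionValue P c β V s u) (s : S) : optimalCost P c β s = V s := by
  obtain ⟨f, hf⟩ := exists_greedy P c hV
  have : Nonempty (Policy S U) := ⟨Policy.stationary f (measurable_of_finite f)⟩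
  refine le_antisymm ?_ (le_ciInf fun γ => bellman_le_discountedCost P c hβ0 hβ1 hV γ s)
  rw [← discountedCost_greedy P c hβ0 hβ1 hV hf s]
  refine ciInf_le ⟨V s, ?_⟩ _
  rintro _ ⟨γ, rfl⟩
  exact bellman_le_discountedCost P c hβ0 hβ1 hV γ s

theorem exists_isOptimalStationary [Nonempty U] (P : Kernel (S × U) S) [IsMarkovKernel P]
    (c : S → U → ℝ) {β : ℝ} (hβ0 : 0 ≤ β) (hβ1 : β < 1) :
    ∃ f : S → U, IsOptimalStationary P c β f (measurable_of_finite f) := by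
  obtain ⟨V, hV⟩ := exists_bellman_fixed_point P c hβ0 hβ1
  obtain ⟨f, hf⟩ := exists_greedy P c hV
  exact ⟨f, fun s => (discountedCost_greedy P c hβ0 hβ1 hV hf s).trans
    (optimalCost_eq_of_bellman P c hβ0 hβ1 hV s).symm⟩

/-- An optimal stationary policy attains the minimum in the Bellman equation at every state: started
at `s`, its Bellman residuals are nonnegative and have discounted sum `0`, so the residual at
time `0` vanishes. -/
theorem IsOptimalStationary.greedy [Nonempty U] {P : Kernel (S × U) S} [IsMarkovKernel P]
    {c : S → U → ℝ} {β : ℝ} (hβ0 : 0 ≤ β) (hβ1 : β < 1) {V : S → ℝ}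
    (hV : ∀ s, V s = ⨅ u, actionValue P c β V s u) {f : S → U}
    (hf : IsOptimalStationary P c β f (measurable_of_finite f)) (s : S) :
    actionValue P c β V s (f s) = V s := by
  obtain ⟨K, hK⟩ := (Set.finite_range fun p : S × U => |c p.1 p.2|).bddAbove
  obtain ⟨K', hK'⟩ := (Set.finite_range fun s => |V s|).bddAbove
  have h := hasSum_discountedCost_sub P (measurable_of_finite (Function.uncurry c))
    (fun x u => hK ⟨(x, u), rfl⟩) hβ0 hβ1 (measurable_of_finite V) (fun x => hK' ⟨x, rfl⟩)
    (Policy.stationary f (measurable_of_finite f)) s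
  rw [hf s, optimalCost_eq_of_bellman P c hβ0 hβ1 hV s, sub_self,
    hasSum_zero_iff_of_nonneg] at h
  · have h0 := congrFun h 0
    have hm := integral_map
      (μ := pathLaw P (Policy.stationary f (measurable_of_finite f)) s) (φ := fun ω => ω 0)
      (f := fun p : S × U => actionValue P c β V p.1 p.2 - V p.1)
      (measurable_pi_apply 0).aemeasurable (measurable_of_finite _).aestronglyMeasurable
    rw [map_zero_pathLaw, integral_dirac] at hm
    rw [← hm] at h0
    simpa [Policy.stationary, sub_eq_zero] using h0
  · refine fun t => mul_nonneg (pow_nonneg hβ0 t) (integral_nonneg fun ω => ?_)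
    have h2 := ciInf_le (Set.finite_range (actionValue P c β V (ω t).1)).bddBelow (ω t).2
    rw [← hV] at h2
    exact sub_nonneg.2 h2

end Finite

/-! ### Total variation and functions with finitely many values -/

theorem bddAbove_tv {X : Type*} [MeasurableSpace X] (μ ν : Measure X) [IsProbabilityMeasure μ]
    [IsProbabilityMeasure ν] :
    BddAbove (Set.range fun B : {B : Set X // MeasurableSet B} => |μ.real B.1 - ν.real B.1|) := by
  refine ⟨1, ?_⟩
  rintro _ ⟨B, rfl⟩
  have h1 := measureReal_le_one (μ := μ) (s := B.1)
  have h2 := measureReal_le_one (μ := ν) (s := B.1)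
  have h3 := measureReal_nonneg (μ := μ) (s := B.1)
  have h4 := measureReal_nonneg (μ := ν) (s := B.1)
  exact abs_le.2 ⟨by linarith, by linarith⟩

theorem integral_comp_eq_sum {X S : Type*} [MeasurableSpace X] [Fintype S] [MeasurableSpace S]
    [MeasurableSingletonClass S] (μ : Measure X) [IsFiniteMeasure μ] {q : X → S}
    (hq : Measurable q) (V : S → ℝ) :
    ∫ x, V (q x) ∂μ = ∑ z, μ.real (q ⁻¹' {z}) * V z := by
  rw [← integral_map (f := V) hq.aemeasurable (measurable_of_finite V).aestronglyMeasurable,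
    integral_fintype .of_finite]
  refine Finset.sum_congr rfl fun z _ => ?_
  rw [smul_eq_mul, map_measureReal_apply hq (measurableSet_singleton z)]

/-- For `d z = μ(q = z) - ν(q = z)`, the sum of `|d z|` splits into the `z` with `d z ≥ 0` and those
with `d z < 0`. Each part is the difference of `μ` and `ν` on a single measurable set, hence at most
half of `tvDist μ ν`. -/
theorem abs_integral_comp_sub_le_mul_tvDist {X S : Type*} [MeasurableSpace X] [Finite S]
    [MeasurableSpace S] [MeasurableSingletonClass S] (μ ν : Measure X) [IsProbabilityMeasure μ]
    [IsProbabilityMeasure ν] {q : X → S} (hq : Measurable q) {V : S → ℝ} {M : ℝ}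
    (hM0 : 0 ≤ M) (hM : ∀ z, |V z| ≤ M) :
    |(∫ x, V (q x) ∂μ) - ∫ x, V (q x) ∂ν| ≤ M * tvDist μ ν := by
  classical
  have := Fintype.ofFinite S
  set d : S → ℝ := fun z => μ.real (q ⁻¹' {z}) - ν.real (q ⁻¹' {z}) with hd
  have hA : ∀ A : Finset S, |∑ z ∈ A, d z| ≤ tvDist μ ν / 2 := fun A => by
    have hm : MeasurableSet (q ⁻¹' (A : Set S)) := hq A.measurableSet
    have hsum : ∑ z ∈ A, d z = μ.real (q ⁻¹' A) - ν.real (q ⁻¹' A) := by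
      rw [hd, Finset.sum_sub_distrib,
        sum_measureReal_preimage_singleton A fun z _ => hq (measurableSet_singleton z),
        sum_measureReal_preimage_singleton A fun z _ => hq (measurableSet_singleton z)]
    rw [hsum, tvDist, mul_div_cancel_left₀ _ two_ne_zero]
    exact le_ciSup (bddAbove_tv μ ν) ⟨_, hm⟩
  rw [integral_comp_eq_sum μ hq, integral_comp_eq_sum ν hq, ← Finset.sum_sub_distrib]
  simp only [← sub_mul]
  calc |∑ z, d z * V z| ≤ ∑ z, |d z| * M := by
        refine (Finset.abs_sum_le_sum_abs _ _).trans (Finset.sum_le_sum fun z _ => ?_)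
        rw [abs_mul]
        exact mul_le_mul_of_nonneg_left (hM z) (abs_nonneg _)
    _ = M * (∑ z with 0 ≤ d z, d z - ∑ z with ¬ 0 ≤ d z, d z) := by
        rw [← Finset.sum_mul, mul_comm, ← Finset.sum_filter_add_sum_filter_not _ (fun z => 0 ≤ d z),
          sub_eq_add_neg, ← Finset.sum_neg_distrib]
        congr 2
        · exact Finset.sum_congr rfl fun z hz => abs_of_nonneg (Finset.mem_filter.1 hz).2
        · exact Finset.sum_congr rfl fun z hz =>
            abs_of_neg (not_le.1 (Finset.mem_filter.1 hz).2)
    _ ≤ M * tvDist μ ν := by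
        refine mul_le_mul_of_nonneg_left ?_ hM0
        linarith [le_abs_self (∑ z with 0 ≤ d z, d z), hA {z | 0 ≤ d z},
          neg_abs_le (∑ z with ¬ 0 ≤ d z, d z), hA {z | ¬ 0 ≤ d z}]

/-! ### Comparison of the model with its quantization -/

namespace Quantization

variable {X U : Type*} [MeasurableSpace X] [MeasurableSpace U]

instance [MeasurableSingletonClass X] (Q : Quantization X) (y : Q.Y) :
    IsProbabilityMeasure ((Q.binMeasure y).restrict (Q.bin y)) :=
  ⟨by rw [Measure.restrict_apply_univ, Q.binMeasure_bin]⟩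

theorem integral_finKernel [MeasurableSingletonClass X] [Countable U] [MeasurableSingletonClass U]
    (Q : Quantization X) (T : Kernel (X × U) X) [IsMarkovKernel T] (V : Q.Y → ℝ) (y : Q.Y)
    (u : U) :
    ∫ z, V z ∂(Q.finKernel T (y, u)) =
      ∫ x in Q.bin y, ∫ x', V (Q.q x') ∂(T (x, u)) ∂(Q.binMeasure y) := by
  have hm : ∀ z, Measurable fun x => T (x, u) (Q.bin z) := fun z =>
    (T.measurable_coe (Q.measurableSet_bin z)).comp measurable_prodMk_right
  have hfin : ∀ z : Q.Y, Q.finProb T y u z ≠ ⊤ := fun z => ne_top_of_le_ne_top ENNReal.one_ne_top <|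
    (Finset.single_le_sum (f := Q.finProb T y u) (fun _ _ => zero_le) (Finset.mem_univ z)).trans_eq
      (Q.sum_finProb T y u)
  have hreal : ∀ z, ∫ x in Q.bin y, (T (x, u)).real (Q.bin z) ∂(Q.binMeasure y) =
      (Q.finProb T y u z).toReal := fun z =>
    integral_toReal (hm z).aemeasurable
      (Filter.Eventually.of_forall fun x => measure_lt_top _ _)
  have hint : ∀ z, Integrable (fun x => (T (x, u)).real (Q.bin z))
      ((Q.binMeasure y).restrict (Q.bin y)) := fun z =>
    .of_bound (hm z).ennreal_toReal.aestronglyMeasurable 1 (Filter.Eventually.of_forall fun x => by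
      rw [Real.norm_eq_abs, abs_of_nonneg measureReal_nonneg]
      exact measureReal_le_one)
  simp only [fun x => integral_comp_eq_sum (T (x, u)) Q.measurable_q V]
  change _ = ∫ x in Q.bin y, ∑ z, (T (x, u)).real (Q.bin z) * V z ∂(Q.binMeasure y)
  rw [integral_finsetSum _ fun z _ => (hint z).mul_const _]
  change ∫ z, V z ∂(∑ z : Q.Y, Q.finProb T y u z • Measure.dirac z) = _
  rw [integral_finsetSum_measure fun z _ => .smul_measure .of_finite (hfin z)]
  refine Finset.sum_congr rfl fun z _ => ?_
  rw [integral_smul_measure, integral_dirac, integral_mul_const, hreal, smul_eq_mul]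

/-- The backup of `V` in the finite model is the average, over the bin of `y`, of the backup of the
piecewise constant function `V ∘ q` in the original model. -/
theorem actionValue_finKernel [MeasurableSingletonClass X] [Countable U]
    [MeasurableSingletonClass U]
    (Q : Quantization X) (T : Kernel (X × U) X) [IsMarkovKernel T] {c : X → U → ℝ}
    (hc : Measurable (Function.uncurry c)) {K : ℝ} (hK : ∀ x u, |c x u| ≤ K) (β : ℝ)
    (V : Q.Y → ℝ) (y : Q.Y) (u : U) :
    actionValue (Q.finKernel T) (Q.finCost c) β V y u =
      ∫ x in Q.bin y, actionValue T c β (V ∘ Q.q) x u ∂(Q.binMeasure y) := by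
  obtain ⟨K', hK'⟩ := (Set.finite_range fun s => |V s|).bddAbove
  have i1 : Integrable (fun x => c x u) ((Q.binMeasure y).restrict (Q.bin y)) :=
    .of_bound (hc.comp measurable_prodMk_right).aestronglyMeasurable K
      (Filter.Eventually.of_forall fun x => hK x u)
  have i2 : Integrable (fun x => ∫ x', V (Q.q x') ∂(T (x, u)))
      ((Q.binMeasure y).restrict (Q.bin y)) :=
    .of_bound ((((measurable_of_finite V).comp
      Q.measurable_q).stronglyMeasurable.integral_kernel.measurable.comp
        measurable_prodMk_right).aestronglyMeasurable) K'
      (Filter.Eventually.of_forall fun x => abs_integral_le_of_bounded _ fun x' => hK' ⟨_, rfl⟩)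
  simp only [actionValue, Function.comp_apply]
  rw [integral_add i1 (i2.const_mul β), integral_const_mul, Q.integral_finKernel]
  rfl

end Quantization

theorem abs_actionValue_sub_le {X S U : Type*} [PseudoMetricSpace X] [MeasurableSpace X]
    [MeasurableSpace U] [Finite S] [MeasurableSpace S] [MeasurableSingletonClass S]
    {T : Kernel (X × U) X} [IsMarkovKernel T] {c : X → U → ℝ} {αc αT : ℝ}
    (hcLip : ∀ x x' u, |c x u - c x' u| ≤ αc * dist x x')
    (hTLip : ∀ x x' u, tvDist (T (x, u)) (T (x', u)) ≤ αT * dist x x')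
    {β : ℝ} (hβ0 : 0 ≤ β) {q : X → S} (hq : Measurable q) {V : S → ℝ} {M : ℝ} (hM0 : 0 ≤ M)
    (hM : ∀ z, |V z| ≤ M) (x x' : X) (u : U) :
    |actionValue T c β (V ∘ q) x u - actionValue T c β (V ∘ q) x' u| ≤
      (αc + β * αT * M) * dist x x' := by
  have h := (abs_integral_comp_sub_le_mul_tvDist (T (x, u)) (T (x', u)) hq hM0 hM).trans
    (mul_le_mul_of_nonneg_left (hTLip x x' u) hM0)
  rw [actionValue, actionValue, add_sub_add_comm, ← mul_sub]
  refine (abs_add_le _ _).trans ?_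
  rw [abs_mul, abs_of_nonneg hβ0]
  calc _ ≤ αc * dist x x' + β * (M * (αT * dist x x')) :=
        add_le_add (hcLip x x' u) (mul_le_mul_of_nonneg_left h hβ0)
    _ = _ := by ring

/-- Replacing the backup at `x` by its average over the bin of `x` costs at most a multiple of the
loss at `x`. -/
theorem Quantization.ofReal_abs_actionValue_sub_le {X U : Type*} [MetricSpace X]
    [MeasurableSpace X] [MeasurableSingletonClass X] [MeasurableSpace U] [Countable U]
    [MeasurableSingletonClass U] (Q : Quantization X)
    {T : Kernel (X × U) X} [IsMarkovKernel T] {c : X → U → ℝ}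
    (hc : Measurable (Function.uncurry c)) {K : ℝ} (hK : ∀ x u, |c x u| ≤ K) {αc αT : ℝ}
    (hcLip : ∀ x x' u, |c x u - c x' u| ≤ αc * dist x x')
    (hTLip : ∀ x x' u, tvDist (T (x, u)) (T (x', u)) ≤ αT * dist x x')
    {β : ℝ} (hβ0 : 0 ≤ β) {V : Q.Y → ℝ} {M : ℝ} (hM0 : 0 ≤ M) (hM : ∀ z, |V z| ≤ M)
    (hL : 0 ≤ αc + β * αT * M) (x : X) (u : U) :
    ENNReal.ofReal |actionValue T c β (V ∘ Q.q) x u -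
        actionValue (Q.finKernel T) (Q.finCost c) β V (Q.q x) u| ≤
      ENNReal.ofReal (αc + β * αT * M) * Q.loss x := by
  have hi : Integrable (fun x' => actionValue T c β (V ∘ Q.q) x' u)
      ((Q.binMeasure (Q.q x)).restrict (Q.bin (Q.q x))) :=
    .of_bound (measurable_actionValue T hc β ((measurable_of_finite V).comp Q.measurable_q)
      u).aestronglyMeasurable (K + β * M)
      (Filter.Eventually.of_forall fun x' => abs_actionValue_le T hK hβ0 (fun _ => hM _) x' u)
  have hsub : actionValue T c β (V ∘ Q.q) x u -
        actionValue (Q.finKernel T) (Q.finCost c) β V (Q.q x) u =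
      ∫ x' in Q.bin (Q.q x), (actionValue T c β (V ∘ Q.q) x u -
        actionValue T c β (V ∘ Q.q) x' u) ∂(Q.binMeasure (Q.q x)) := by
    rw [integral_sub (integrable_const _) hi, Q.actionValue_finKernel T hc hK]
    simp
  rw [hsub, ← Real.enorm_eq_ofReal_abs, loss, ← lintegral_const_mul' _ _ ENNReal.ofReal_ne_top]
  refine (enorm_integral_le_lintegral_enorm _).trans (lintegral_mono fun x' => ?_)
  rw [Real.enorm_eq_ofReal_abs, edist_dist, ← ENNReal.ofReal_mul hL]
  exact ENNReal.ofReal_le_ofReal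
    (abs_actionValue_sub_le hcLip hTLip hβ0 Q.measurable_q hM0 hM _ _ _)

end QuantizedMDP

open QuantizedMDP in
theorem theorem4 {X U : Type*}
    [MetricSpace X] [SecondCountableTopology X] [MeasurableSpace X] [BorelSpace X]
    [StandardBorelSpace X]
    [Finite U] [Nonempty U] [MeasurableSpace U] [MeasurableSingletonClass U]
    (T : Kernel (X × U) X) [IsMarkovKernel T]
    (c : X → U → ℝ) (hc : ∃ K : ℝ, ∀ x u, |c x u| ≤ K)
    (β : ℝ) (hβ0 : 0 < β) (hβ1 : β < 1)
    (αc : ℝ) (hαc : 0 < αc)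
    (hcLip : ∀ (x x' : X) (u : U), |c x u - c x' u| ≤ αc * dist x x')
    (αT : ℝ) (hαT : 0 < αT)
    (hTLip : ∀ (x x' : X) (u : U),
      QuantizedMDP.tvDist (T (x, u)) (T (x', u)) ≤ αT * dist x x')
    (Q : QuantizedMDP.Quantization X) :
    (∃ f : Q.Y → U, QuantizedMDP.IsOptimalStationary (Q.finKernel T) (Q.finCost c) β
      f (measurable_of_finite f)) ∧
    ∀ f : Q.Y → U, QuantizedMDP.IsOptimalStationary (Q.finKernel T) (Q.finCost c) β
      f (measurable_of_finite f) →
    ∀ x₀ : X,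
      ENNReal.ofReal
        |QuantizedMDP.discountedCost T c β x₀
            (QuantizedMDP.Policy.stationary (fun x => f (Q.q x))
              ((measurable_of_finite f).comp Q.measurable_q))
          - QuantizedMDP.optimalCost T c β x₀|
      ≤ ENNReal.ofReal (2 * (αc + β * αT * (⨆ p : X × U, |c p.1 p.2|) / (1 - β)))
        * ∑' t : ℕ, ENNReal.ofReal (β ^ t)
          * ⨆ γ : QuantizedMDP.Policy X U,
              ∫⁻ ω, Q.loss (ω t).1 ∂(QuantizedMDP.pathLaw T γ x₀) := by
  refine ⟨exists_isOptimalStationary _ _ hβ0.le hβ1, fun f hf x₀ => ?_⟩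
  obtain ⟨V, hV⟩ := exists_bellman_fixed_point (Q.finKernel T) (Q.finCost c) hβ0.le hβ1
  have hgreedy := hf.greedy hβ0.le hβ1 hV
  have hcm : Measurable (Function.uncurry c) :=
    measurable_from_prod_countable_left fun u =>
      (LipschitzWith.of_dist_le_mul (K := ⟨αc, hαc.le⟩)
        fun x x' => hcLip x x' u).continuous.measurable
  -- `K` is the supremum norm of `c`; it bounds the averaged cost of the finite model as well.
  set K : ℝ := ⨆ p : X × U, |c p.1 p.2|
  have hK : ∀ x u, |c x u| ≤ K := by
    obtain ⟨K₁, hK₁⟩ := hc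
    refine fun x u => le_ciSup (f := fun p : X × U => |c p.1 p.2|) ⟨K₁, ?_⟩ (x, u)
    rintro _ ⟨p, rfl⟩
    exact hK₁ p.1 p.2
  have hK0 : 0 ≤ K := Real.iSup_nonneg fun p => abs_nonneg _
  have hM0 : 0 ≤ K / (1 - β) := div_nonneg hK0 (sub_nonneg.2 hβ1.le)
  have hM : ∀ y, |V y| ≤ K / (1 - β) := fun y => by
    rw [← optimalCost_eq_of_bellman _ _ hβ0.le hβ1 hV y, ← hf y]
    exact abs_discountedCost_le _ (measurable_of_finite _)
      (fun y u => abs_integral_le_of_bounded _ fun x => hK x u) hβ0.le hβ1 _ _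
  have hL0 : 0 ≤ αc + β * αT * (K / (1 - β)) := by positivity
  have hdiff := Q.ofReal_abs_actionValue_sub_le hcm hK hcLip hTLip hβ0.le hM0 hM hL0
  set C : ℝ≥0∞ := ENNReal.ofReal (αc + β * αT * (K / (1 - β)))
  set S : ℝ≥0∞ := ∑' t : ℕ, ENNReal.ofReal (β ^ t) *
    ⨆ γ : Policy X U, ∫⁻ ω, Q.loss (ω t).1 ∂(pathLaw T γ x₀) with hS
  have hvm : Measurable (V ∘ Q.q) := (measurable_of_finite V).comp Q.measurable_q
  have hsum : ∀ γ : Policy X U, ∑' t : ℕ, ENNReal.ofReal (β ^ t) *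
      ∫⁻ ω, C * Q.loss (ω t).1 ∂(pathLaw T γ x₀) ≤ C * S := fun γ => by
    rw [hS, ← ENNReal.tsum_mul_left]
    refine ENNReal.tsum_le_tsum fun t => ?_
    rw [lintegral_const_mul' _ _ ENNReal.ofReal_ne_top, mul_left_comm]
    gcongr
    exact le_iSup (fun γ : Policy X U => ∫⁻ ω, Q.loss (ω t).1 ∂(pathLaw T γ x₀)) γ
  have hlow : ∀ γ : Policy X U,
      ENNReal.ofReal (V (Q.q x₀) - discountedCost T c β x₀ γ) ≤ C * S := fun γ => by
    refine (ofReal_value_sub_discountedCost_le T hcm hK hβ0.le hβ1 hvm (fun x => hM (Q.q x))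
      (e := fun x => C * Q.loss x) (fun x u => ?_) γ x₀).trans (hsum γ)
    refine (ENNReal.ofReal_le_ofReal ?_).trans (hdiff x u)
    have h1 := ciInf_le (Set.finite_range
      (actionValue (Q.finKernel T) (Q.finCost c) β V (Q.q x))).bddBelow u
    rw [← hV] at h1
    rw [Function.comp_apply, abs_sub_comm]
    exact (sub_le_sub_right h1 _).trans (le_abs_self _)
  set γ' : Policy X U := Policy.stationary (fun x => f (Q.q x))
    ((measurable_of_finite f).comp Q.measurable_q)
  have hup : ENNReal.ofReal (discountedCost T c β x₀ γ' - V (Q.q x₀)) ≤ C * S := by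
    refine (ofReal_discountedCost_stationary_sub_le T hcm hK hβ0.le hβ1 hvm
      (fun x => hM (Q.q x)) (e := fun x => C * Q.loss x) _ _ (fun x => ?_) x₀).trans (hsum γ')
    refine (ENNReal.ofReal_le_ofReal ?_).trans (hdiff x (f (Q.q x)))
    rw [hgreedy]
    exact le_abs_self _
  -- The factor `2`: one `C * S` for the quantized policy, one for its competitors.
  have h2 : ENNReal.ofReal (2 * (αc + β * αT * K / (1 - β))) * S = C * S + C * S := by
    rw [mul_div_assoc, ENNReal.ofReal_mul zero_le_two, ← two_mul, ENNReal.ofReal_ofNat, mul_assoc]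
  rw [h2]
  by_cases htop : C * S = ⊤
  · simp [htop]
  -- With `v = V ∘ q`, the cost of every policy is at least `v x₀ - C * S`, and that of the
  -- quantized policy is at most `v x₀ + C * S`.
  obtain ⟨r, hr⟩ : ∃ r : NNReal, C * S = r := ⟨_, (ENNReal.coe_toNNReal htop).symm⟩
  have hle : ∀ a : ℝ, ENNReal.ofReal a ≤ C * S → a ≤ r := fun a ha => by
    rw [hr, ← ENNReal.ofReal_coe_nnreal, ENNReal.ofReal_le_ofReal_iff r.coe_nonneg] at ha
    exact ha
  have hne : Nonempty (Policy X U) := ⟨γ'⟩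
  have hlow' : V (Q.q x₀) - r ≤ optimalCost T c β x₀ :=
    le_ciInf fun γ => by linarith [hle _ (hlow γ)]
  have hopt : optimalCost T c β x₀ ≤ discountedCost T c β x₀ γ' := by
    refine ciInf_le ⟨V (Q.q x₀) - r, ?_⟩ γ'
    rintro _ ⟨γ, rfl⟩
    linarith [hle _ (hlow γ)]
  rw [hr, ← ENNReal.coe_add, ← ENNReal.ofReal_coe_nnreal, NNReal.coe_add,
    abs_of_nonneg (sub_nonneg.2 hopt)]
  exact ENNReal.ofReal_le_ofReal (by linarith [hle _ hup])
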